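/- Let $\sigma=\mathrm{Prop}\cup\{R_i\mid i\in I\}$ be a modal signature with finitely many unary proposition letters and finitely many binary actions. A $\sigma$-LTS $M_a$ is a (possibly infinite) $\sigma$-structure $M$ with one distinguished state $a$; it is image-finite if every state has only finitely many successors (along all actions together). Homomorphisms and isomorphisms are those of pointed structures. A directed path from $b_0$ to $b_k$ ($k\ge 0$) is a sequence of transitions $b_0\xrightarrow{i_1}b_1\xrightarrow{i_2}\cdots\xrightarrow{i_k}b_k$ with $R_{i_j}^M(b_{j-1},b_j)$ for all $j$. A $\sigma$-tree is a $\sigma$-LTS $T_c$ in which there is exactly one directed path from the root $c$ to each state; $\mathcal T_\sigma$ is the class of finite $\sigma$-trees. For $T_c\in\mathcal T_\sigma$ and image-finite $M_a$, $\hom_{\mathbb N}(T_c,M_a)\in\mathbb N$ is the (finite) number of homomorphisms from $T_c$ to $M_a$. The unraveling $\mathtt{unr}(M_a)$ is the $\sigma$-LTS whose states are the directed paths of $M$ starting at $a$, whose distinguished state is the empty path, in which $R_i$ holds of $(w,w')$ iff $w'$ extends $w$ by exactly one transition, and that transition has action $R_i$, and in which $p$ holds at $w$ iff $p$ holds in $M$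 at the last state of $w$. Graded modal logic $\mathrm{ML}_\#$ has the formulas $$\varphi ::= p\mid\top\mid\varphi\wedge\varphi\mid\varphi\vee\varphi\mid\neg\varphi\mid\Diamond_i\varphi\mid\Box_i\varphi\mid\Diamond_i^{\ge k}\varphi\qquad(p\in\mathrm{Prop},\ i\in I,\ k\ge 1)$$ with the usual semantics, where $\Diamond_i^{\ge k}\varphi$ says that at least $k$ $R_i$-successors satisfy $\varphi$. **Claim.** For image-finite $\sigma$-LTSs $M_a$ and $N_b$ the following are equivalent: 1. $\hom_{\mathbb N}(T_c,M_a)=\hom_{\mathbb N}(T_c,N_b)$ for every $T_c\in\mathcal T_\sigma$; 2. $\mathtt{unr}(M_a)\cong\mathtt{unr}(N_b)$; 3. $M_a$ and $N_b$ satisfy the same formulas of $\mathrm{ML}_\#$. If moreover in each of $M$ and $N$ no two distinct actions hold of the same pair of states (for instance, if there is only one action), then the same three-way equivalence holds when the actions are forgotten along directed paths, that is, when a $\sigma$-tree is required to have exactly one sequence of states $c=b_0,b_1,\dots,b_k=m$, with some action from each $b_j$ to $b_{j+1}$, from the root $c$ to each state $m$, and when the states of $\mathtt{unr}(M_a)$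 are the sequences $w=\langle w_1,\dots,w_n\rangle$ of states of $M$ with $w_1=a$ and some action from each $w_j$ to $w_{j+1}$, with $R_i$ holding of $(w,w^\frown\langle u\rangle)$ iff $R_i^M(w_n,u)$ and $p$ holding at $w$ iff $p^M(w_n)$. -/

import Mathlib

universe uP uI u v

/-- A labelled transition system over the modal signature with proposition letters `P` and
actions `I`: a first-order structure with one distinguished state. -/
structure LTS (P : Type uP) (I : Type uI) where
  State : Type u
  prop : P → State → Prop
  act : I → State → State → Prop
  pt : State

/-- Formulas of graded modal logic: the basic multimodal language (with the constant `⊤`)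
together with the graded modalities `◇_i^{≥ k}`, `k ≥ 1`. -/
inductive GMLFormula (P : Type uP) (I : Type uI) where
  | prop (p : P) : GMLFormula P I
  | top : GMLFormula P I
  | and (φ ψ : GMLFormula P I) : GMLFormula P I
  | or (φ ψ : GMLFormula P I) : GMLFormula P I
  | neg (φ : GMLFormula P I) : GMLFormula P I
  | dia (i : I) (φ : GMLFormula P I) : GMLFormula P I
  | box (i : I) (φ : GMLFormula P I) : GMLFormula P I
  | gdia (i : I) (k : ℕ+) (φ : GMLFormula P I) : GMLFormula P I

namespace LTS

variable {P : Type uP} {I : Type uI}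

/-- Some action leads from `m` to `n`. -/
def Succ (M : LTS.{uP, uI, u} P I) (m n : M.State) : Prop := ∃ i, M.act i m n

def ImageFinite (M : LTS.{uP, uI, u} P I) : Prop := ∀ m, {n | M.Succ m n}.Finite

/-- Homomorphisms of pointed structures. -/
@[ext] structure Hom (M : LTS.{uP, uI, u} P I) (N : LTS.{uP, uI, v} P I) where
  toFun : M.State → N.State
  map_pt : toFun M.pt = N.pt
  map_prop : ∀ p m, M.prop p m → N.prop p (toFun m)
  map_act : ∀ i m n, M.act i m n → N.act i (toFun m) (toFun n)

/-- There is a bijective homomorphism whose inverse is a homomorphism. -/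
def Isomorphic (M : LTS.{uP, uI, u} P I) (N : LTS.{uP, uI, v} P I) : Prop :=
  ∃ (h : Hom M N) (g : Hom N M),
    Function.LeftInverse g.toFun h.toFun ∧ Function.RightInverse g.toFun h.toFun

/-- The homomorphism count over the semiring of natural numbers. It is only used for finite trees
`T` and image-finite `M`, where `Hom T M` is finite (`finite_hom_of_isTree`,
`finite_hom_of_isPairTree` below). -/
noncomputable def homCount (T : LTS.{uP, uI, u} P I) (M : LTS.{uP, uI, v} P I) : ℕ :=
  Nat.card (Hom T M)

/-- Equality of the left homomorphism vectors of `M` and `N` restricted to the class of finite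
structures satisfying `C`. (Every finite structure is isomorphic to one in `Type`.) -/
def HomVectorEq (C : LTS.{uP, uI, 0} P I → Prop)
    (M : LTS.{uP, uI, u} P I) (N : LTS.{uP, uI, v} P I) : Prop :=
  ∀ T : LTS.{uP, uI, 0} P I, Finite T.State → C T → homCount T M = homCount T N

/-! ### Directed paths as sequences of labelled transitions -/

/-- `[(i₁, b₁), …, (iₖ, bₖ)]` describes a directed path `b₀ -i₁→ b₁ -i₂→ ⋯ -iₖ→ bₖ` from `b₀`. -/
def IsRun (M : LTS.{uP, uI, u} P I) : M.State → List (I × M.State) → Prop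
  | _, [] => True
  | m, (i, n) :: l => M.act i m n ∧ M.IsRun n l

/-- The last state of a directed path from `m`. -/
def endpoint (M : LTS.{uP, uI, u} P I) : M.State → List (I × M.State) → M.State
  | m, [] => m
  | _, (_, n) :: l => M.endpoint n l

/-- A tree: exactly one directed path (sequence of transitions) from the root to each state. -/
def IsTree (M : LTS.{uP, uI, u} P I) : Prop :=
  ∀ m, ∃! l : List (I × M.State), M.IsRun M.pt l ∧ M.endpoint M.pt l = m

/-- The unraveling: its states are the directed paths from the distinguished state. -/
def unravel (M : LTS.{uP, uI, u} P I) : LTS.{uP, uI, max uI u} P I where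
  State := {l : List (I × M.State) // M.IsRun M.pt l}
  prop p l := M.prop p (M.endpoint M.pt l.1)
  act i l l' := ∃ n, M.act i (M.endpoint M.pt l.1) n ∧ l'.1 = l.1 ++ [(i, n)]
  pt := ⟨[], trivial⟩

/-! ### Directed paths as sequences of states, with the actions forgotten -/

/-- `l = [b₀, …, bₖ]` with `b₀ = m` and, for each `j < k`, some action from `bⱼ` to `bⱼ₊₁`. -/
def IsStateRun (M : LTS.{uP, uI, u} P I) (m : M.State) (l : List M.State) : Prop :=
  l.head? = some m ∧ l.IsChain M.Succ

/-- Exactly one sequence of states leads from the root to each state; a transition of such a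
tree may carry more than one action. -/
def IsPairTree (M : LTS.{uP, uI, u} P I) : Prop :=
  ∀ m, ∃! l : List M.State, M.IsStateRun M.pt l ∧ l.getLast? = some m

/-- The unraveling whose states are the sequences of states along directed paths. -/
def stateUnravel (M : LTS.{uP, uI, u} P I) : LTS.{uP, uI, u} P I where
  State := {l : List M.State // M.IsStateRun M.pt l}
  prop p l := ∃ m, l.1.getLast? = some m ∧ M.prop p m
  act i l l' := ∃ m n, l.1.getLast? = some m ∧ M.act i m n ∧ l'.1 = l.1 ++ [n]
  pt := ⟨[M.pt], rfl, List.isChain_singleton _⟩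

/-- No two distinct actions lead from one state to the same state. -/
def ActionsDisjoint (M : LTS.{uP, uI, u} P I) : Prop :=
  ∀ i j m n, M.act i m n → M.act j m n → i = j

/-! ### Graded modal equivalence -/

/-- Truth of a graded modal formula at a state. -/
def Sat (M : LTS.{uP, uI, u} P I) : GMLFormula P I → M.State → Prop
  | .prop p, m => M.prop p m
  | .top, _ => True
  | .and φ ψ, m => M.Sat φ m ∧ M.Sat ψ m
  | .or φ ψ, m => M.Sat φ m ∨ M.Sat ψ m
  | .neg φ, m => ¬ M.Sat φ m
  | .dia i φ, m => ∃ n, M.act i m n ∧ M.Sat φ n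
  | .box i φ, m => ∀ n, M.act i m n → M.Sat φ n
  | .gdia i k φ, m => ((k : ℕ) : ℕ∞) ≤ {n | M.act i m n ∧ M.Sat φ n}.encard

/-- `M` and `N` satisfy the same formulas of graded modal logic. -/
def GMLEquiv (M : LTS.{uP, uI, u} P I) (N : LTS.{uP, uI, v} P I) : Prop :=
  ∀ φ : GMLFormula P I, M.Sat φ M.pt ↔ N.Sat φ N.pt

/-! ### The homomorphism counts are well defined -/

theorem finite_hom_of_reachable (T : LTS.{uP, uI, u} P I) (M : LTS.{uP, uI, v} P I)
    [Finite T.State] (hT : ∀ m, Relation.ReflTransGen T.Succ T.pt m) (hM : M.ImageFinite) :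
    Finite (Hom T M) := by
  have key : ∀ m, {x | ∃ h : Hom T M, h.toFun m = x}.Finite := by
    intro m
    induction hT m with
    | refl =>
      refine (Set.finite_singleton M.pt).subset ?_
      rintro x ⟨h, rfl⟩
      exact h.map_pt
    | tail _ hs ih =>
      obtain ⟨i, hi⟩ := hs
      refine (ih.biUnion fun y _ => hM y).subset ?_
      rintro x ⟨h, rfl⟩
      exact Set.mem_biUnion ⟨h, rfl⟩ ⟨i, h.map_act _ _ _ hi⟩
  have : ∀ m, Finite {x | ∃ h : Hom T M, h.toFun m = x} := fun m => (key m).to_subtype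
  refine Finite.of_injective
    (fun (h : Hom T M) (m : T.State) =>
      (⟨h.toFun m, h, rfl⟩ : {x | ∃ h : Hom T M, h.toFun m = x})) ?_
  intro h g e
  ext m
  exact congrArg Subtype.val (congrFun e m)

theorem IsRun.reachable {M : LTS.{uP, uI, u} P I} :
    ∀ (l : List (I × M.State)) (m : M.State), M.IsRun m l →
      Relation.ReflTransGen M.Succ m (M.endpoint m l)
  | [], _, _ => .refl
  | (i, _) :: l, _, h => .head ⟨i, h.1⟩ (IsRun.reachable l _ h.2)

theorem IsStateRun.reachable {M : LTS.{uP, uI, u} P I} :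
    ∀ (l : List M.State) (m n : M.State), M.IsStateRun m l → l.getLast? = some n →
      Relation.ReflTransGen M.Succ m n
  | [], _, _, h, _ => by simp [IsStateRun] at h
  | [a], m, n, h, e => by
    simp only [IsStateRun, List.head?_cons, Option.some.injEq] at h
    simp only [List.getLast?_singleton, Option.some.injEq] at e
    rw [← h.1, e]
  | a :: b :: l, m, n, h, e => by
    simp only [IsStateRun, List.head?_cons, Option.some.injEq, List.isChain_cons_cons] at h
    obtain ⟨rfl, hab, hl⟩ := h
    exact .head hab (IsStateRun.reachable (b :: l) b n ⟨rfl, hl⟩ (by simpa using e))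

theorem finite_hom_of_isTree (T : LTS.{uP, uI, u} P I) (M : LTS.{uP, uI, v} P I)
    [Finite T.State] (hT : T.IsTree) (hM : M.ImageFinite) : Finite (Hom T M) :=
  finite_hom_of_reachable T M
    (fun m => by obtain ⟨l, ⟨h, rfl⟩, _⟩ := hT m; exact h.reachable) hM

theorem finite_hom_of_isPairTree (T : LTS.{uP, uI, u} P I) (M : LTS.{uP, uI, v} P I)
    [Finite T.State] (hT : T.IsPairTree) (hM : M.ImageFinite) : Finite (Hom T M) :=
  finite_hom_of_reachable T M
    (fun m => by obtain ⟨l, ⟨h, e⟩, _⟩ := hT m; exact h.reachable _ _ _ e) hM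

end LTS

/-- Two finite families of points carrying the same sums of a multiplicatively closed family of
functions are matched by a bijection that preserves all these functions. -/
theorem exists_equiv_of_sum_eq {X : Type u} {Y : Type v} {J : Type*} [Fintype X] [Fintype Y]
    (f : J → X → ℚ) (g : J → Y → ℚ)
    (one : ∃ j, (∀ x, f j x = 1) ∧ ∀ y, g j y = 1)
    (mul : ∀ j k, ∃ l, (∀ x, f l x = f j x * f k x) ∧ ∀ y, g l y = g j y * g k y)
    (sum : ∀ j, ∑ x, f j x = ∑ y, g j y) :
    ∃ e : X ≃ Y, ∀ j x, g j (e x) = f j x := by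
  classical
  -- `J` carries no monoid structure, so the characters live on the free monoid over it.
  let F : X → FreeMonoid J →* ℚ := fun x => FreeMonoid.lift fun j => f j x
  let G : Y → FreeMonoid J →* ℚ := fun y => FreeMonoid.lift fun j => g j y
  -- Closure under products collapses the value at a word to a single index, where the sums are
  -- known to agree.
  have word : ∀ w : FreeMonoid J, ∃ j, (∀ x, f j x = F x w) ∧ ∀ y, g j y = G y w := by
    intro w
    induction w using FreeMonoid.inductionOn' with
    | one => simpa using one
    | of_mul j w ih =>
      obtain ⟨k, hk₁, hk₂⟩ := ih
      obtain ⟨l, hl₁, hl₂⟩ := mul j k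
      exact ⟨l, fun x => by simp [hl₁, hk₁, F], fun y => by simp [hl₂, hk₂, G]⟩
  have key : (∑ x, Finsupp.single (F x) (1 : ℚ)) = ∑ y, Finsupp.single (G y) (1 : ℚ) := by
    refine (linearIndependent_monoidHom (FreeMonoid J) ℚ) ?_
    ext w
    obtain ⟨j, hj₁, hj₂⟩ := word w
    simpa [map_sum, Finsupp.linearCombination_single, hj₁, hj₂] using sum j
  -- The coefficient of a character `c` is the size of its fibre, read back from ℚ by characteristic
  -- zero.
  have card : ∀ c, Fintype.card {x // F x = c} = Fintype.card {y // G y = c} := by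
    intro c
    have := DFunLike.congr_fun key c
    simp only [Finsupp.finsetSum_apply, Finsupp.single_apply, Finset.sum_boole] at this
    rw [Fintype.card_subtype, Fintype.card_subtype]
    exact_mod_cast this
  refine ⟨Equiv.ofFiberEquiv fun c => Fintype.equivOfCardEq (card c), fun j x => ?_⟩
  have h : G (Equiv.ofFiberEquiv (fun c => Fintype.equivOfCardEq (card c)) x) = F x :=
    Equiv.ofFiberEquiv_map _ x
  simpa [F, G] using DFunLike.congr_fun h (FreeMonoid.of j)

namespace LTS

variable {P : Type uP} {I : Type uI}

/-! ### Runs -/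

theorem isRun_append {M : LTS.{uP, uI, u} P I} (l l' : List (I × M.State)) (m : M.State) :
    M.IsRun m (l ++ l') ↔ M.IsRun m l ∧ M.IsRun (M.endpoint m l) l' := by
  induction l generalizing m with
  | nil => simp [IsRun, endpoint]
  | cons a l ih => simp [IsRun, endpoint, ih, and_assoc]

theorem endpoint_append {M : LTS.{uP, uI, u} P I} (l l' : List (I × M.State)) (m : M.State) :
    M.endpoint m (l ++ l') = M.endpoint (M.endpoint m l) l' := by
  induction l generalizing m with
  | nil => rfl
  | cons a l ih => simp [endpoint, ih]

theorem isRun_concat {M : LTS.{uP, uI, u} P I} (l : List (I × M.State)) (m n : M.State) (i : I) :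
    M.IsRun m (l ++ [(i, n)]) ↔ M.IsRun m l ∧ M.act i (M.endpoint m l) n := by
  simp [isRun_append, IsRun]

theorem endpoint_concat {M : LTS.{uP, uI, u} P I} (l : List (I × M.State)) (m n : M.State)
    (i : I) : M.endpoint m (l ++ [(i, n)]) = n := by
  simp [endpoint_append, endpoint]

theorem Hom.isRun_map {M : LTS.{uP, uI, u} P I} {N : LTS.{uP, uI, v} P I} (h : Hom M N)
    (l : List (I × M.State)) (m : M.State) (hl : M.IsRun m l) :
    N.IsRun (h.toFun m) (l.map (Prod.map id h.toFun)) := by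
  induction l generalizing m with
  | nil => trivial
  | cons a l ih => exact ⟨h.map_act _ _ _ hl.1, ih _ hl.2⟩

theorem endpoint_map {M : LTS.{uP, uI, u} P I} {N : LTS.{uP, uI, v} P I} (f : M.State → N.State)
    (l : List (I × M.State)) (m : M.State) :
    N.endpoint (f m) (l.map (Prod.map id f)) = f (M.endpoint m l) := by
  induction l generalizing m with
  | nil => rfl
  | cons a l ih => exact ih a.2

/-! ### Isomorphisms -/

def Hom.comp {M : LTS.{uP, uI, u} P I} {N : LTS.{uP, uI, v} P I} {K : LTS P I}
    (g : Hom N K) (h : Hom M N) : Hom M K where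
  toFun := g.toFun ∘ h.toFun
  map_pt := (congrArg g.toFun h.map_pt).trans g.map_pt
  map_prop p m hm := g.map_prop p _ (h.map_prop p m hm)
  map_act i m n hm := g.map_act i _ _ (h.map_act i m n hm)

theorem Isomorphic.symm {M : LTS.{uP, uI, u} P I} {N : LTS.{uP, uI, v} P I} :
    Isomorphic M N → Isomorphic N M := fun ⟨h, g, h₁, h₂⟩ => ⟨g, h, h₂, h₁⟩

theorem Isomorphic.trans {M : LTS.{uP, uI, u} P I} {N : LTS.{uP, uI, v} P I} {K : LTS P I} :
    Isomorphic M N → Isomorphic N K → Isomorphic M K :=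
  fun ⟨h, g, h₁, h₂⟩ ⟨h', g', h₁', h₂'⟩ =>
    ⟨h'.comp h, g.comp g', h₁'.comp h₁, h₂'.comp h₂⟩

theorem Isomorphic.homCount_eq {M : LTS.{uP, uI, u} P I} {N : LTS.{uP, uI, v} P I}
    (e : Isomorphic M N) (T : LTS P I) : homCount T M = homCount T N := by
  obtain ⟨h, g, h₁, h₂⟩ := e
  refine Nat.card_congr ⟨fun k => h.comp k, fun k => g.comp k, fun k => ?_, fun k => ?_⟩
  · ext x; exact h₁ _
  · ext x; exact h₂ _

/-! ### Homomorphisms from trees lift to the unraveling -/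

theorem IsTree.run_unique {T : LTS.{uP, uI, u} P I} (hT : T.IsTree) {l l' : List (I × T.State)}
    (hl : T.IsRun T.pt l) (hl' : T.IsRun T.pt l')
    (h : T.endpoint T.pt l = T.endpoint T.pt l') : l = l' :=
  (hT _).unique ⟨hl, h⟩ ⟨hl', rfl⟩

/-- The projection of the unraveling. -/
def unravelProj (M : LTS.{uP, uI, u} P I) : Hom M.unravel M where
  toFun l := M.endpoint M.pt l.1
  map_pt := rfl
  map_prop _ _ h := h
  map_act := by
    rintro i l ⟨_, _⟩ ⟨n, h, rfl⟩
    simpa [endpoint_concat] using h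

/-- Each transition of the unraveling appends exactly one entry, so the image of a state records the
whole image path. This gives uniqueness of lifts. -/
theorem unravel_val_eq_map {T : LTS.{uP, uI, u} P I} {M : LTS.{uP, uI, v} P I}
    (g : Hom T M.unravel) (l : List (I × T.State)) (hl : T.IsRun T.pt l) :
    (g.toFun (T.endpoint T.pt l)).1 = l.map (Prod.map id (M.unravelProj.comp g).toFun) := by
  induction l using List.reverseRecOn with
  | nil => exact congrArg Subtype.val g.map_pt
  | append_singleton l a ih =>
    obtain ⟨i, n⟩ := a
    rw [isRun_concat] at hl
    obtain ⟨x, hx, e⟩ := g.map_act _ _ _ hl.2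
    rw [endpoint_concat, e, ih hl.1]
    simp [Hom.comp, unravelProj, e, endpoint_concat]

/-- The path from the root to a state of a tree. -/
noncomputable def IsTree.run {T : LTS.{uP, uI, u} P I} (hT : T.IsTree) (m : T.State) :
    List (I × T.State) := (hT m).choose

theorem IsTree.isRun_run {T : LTS.{uP, uI, u} P I} (hT : T.IsTree) (m : T.State) :
    T.IsRun T.pt (hT.run m) := (hT m).choose_spec.1.1

theorem IsTree.endpoint_run {T : LTS.{uP, uI, u} P I} (hT : T.IsTree) (m : T.State) :
    T.endpoint T.pt (hT.run m) = m := (hT m).choose_spec.1.2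

theorem IsTree.run_pt {T : LTS.{uP, uI, u} P I} (hT : T.IsTree) : hT.run T.pt = [] :=
  hT.run_unique (hT.isRun_run _) trivial (hT.endpoint_run _)

theorem IsTree.run_of_act {T : LTS.{uP, uI, u} P I} (hT : T.IsTree) {i : I} {m n : T.State}
    (h : T.act i m n) : hT.run n = hT.run m ++ [(i, n)] :=
  hT.run_unique (hT.isRun_run n)
    ((isRun_concat _ _ _ _).2 ⟨hT.isRun_run m, by rwa [hT.endpoint_run]⟩)
    (by rw [endpoint_concat, hT.endpoint_run])

theorem IsTree.endpoint_map_run {T : LTS.{uP, uI, u} P I} (hT : T.IsTree)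
    {M : LTS.{uP, uI, v} P I} (h : Hom T M) (m : T.State) :
    M.endpoint M.pt ((hT.run m).map (Prod.map id h.toFun)) = h.toFun m := by
  rw [← h.map_pt, endpoint_map, hT.endpoint_run]

noncomputable def IsTree.lift {T : LTS.{uP, uI, u} P I} (hT : T.IsTree) {M : LTS.{uP, uI, v} P I}
    (h : Hom T M) : Hom T M.unravel where
  toFun m := ⟨(hT.run m).map (Prod.map id h.toFun), by
    rw [← h.map_pt]; exact h.isRun_map _ _ (hT.isRun_run m)⟩
  map_pt := Subtype.ext (congrArg (List.map (Prod.map id h.toFun)) hT.run_pt)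
  map_prop p m hm := by
    change M.prop p (M.endpoint M.pt ((hT.run m).map (Prod.map id h.toFun)))
    rw [hT.endpoint_map_run]
    exact h.map_prop _ _ hm
  map_act i m n hmn := by
    refine ⟨h.toFun n, ?_, by
      simpa using congrArg (List.map (Prod.map id h.toFun)) (hT.run_of_act hmn)⟩
    change M.act i (M.endpoint M.pt ((hT.run m).map (Prod.map id h.toFun))) _
    rw [hT.endpoint_map_run]
    exact h.map_act _ _ _ hmn

theorem IsTree.homCount_unravel {T : LTS.{uP, uI, u} P I} (hT : T.IsTree)
    (M : LTS.{uP, uI, v} P I) : homCount T M.unravel = homCount T M := by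
  refine Nat.card_congr ⟨fun g => M.unravelProj.comp g, fun h => hT.lift h, fun g => ?_,
    fun h => ?_⟩
  · ext m : 2
    apply Subtype.ext
    have := unravel_val_eq_map g _ (hT.isRun_run m)
    rw [hT.endpoint_run] at this
    exact this.symm
  · ext m
    exact hT.endpoint_map_run h m

/-! ### Graded modal formulas are invariant under coverings -/

/-- A map that reflects and preserves propositions and restricts to bijections between the sets of
`i`-successors. -/
structure IsCovering (M : LTS.{uP, uI, u} P I) (N : LTS.{uP, uI, v} P I)
    (f : M.State → N.State) : Prop where
  prop_iff : ∀ p m, N.prop p (f m) ↔ M.prop p m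
  bijOn : ∀ i m, Set.BijOn f {n | M.act i m n} {n | N.act i (f m) n}

theorem IsCovering.sat_iff {M : LTS.{uP, uI, u} P I} {N : LTS.{uP, uI, v} P I}
    {f : M.State → N.State} (hf : IsCovering M N f) (φ : GMLFormula P I) (m : M.State) :
    N.Sat φ (f m) ↔ M.Sat φ m := by
  induction φ generalizing m with
  | prop p => exact hf.prop_iff p m
  | top => exact Iff.rfl
  | and φ ψ h₁ h₂ => simp [Sat, h₁, h₂]
  | or φ ψ h₁ h₂ => simp [Sat, h₁, h₂]
  | neg φ h => simp [Sat, h]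
  | dia i φ h =>
    constructor
    · rintro ⟨n, hn, hφ⟩
      obtain ⟨x, hx, rfl⟩ := (hf.bijOn i m).surjOn hn
      exact ⟨x, hx, (h x).1 hφ⟩
    · rintro ⟨x, hx, hφ⟩
      exact ⟨f x, (hf.bijOn i m).mapsTo hx, (h x).2 hφ⟩
  | box i φ h =>
    constructor
    · intro H x hx
      exact (h x).1 (H _ ((hf.bijOn i m).mapsTo hx))
    · intro H n hn
      obtain ⟨x, hx, rfl⟩ := (hf.bijOn i m).surjOn hn
      exact (h x).2 (H x hx)
  | gdia i k φ h =>
    have : {n | N.act i (f m) n ∧ N.Sat φ n} = f '' {n | M.act i m n ∧ M.Sat φ n} := by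
      ext n
      constructor
      · rintro ⟨hn, hφ⟩
        obtain ⟨x, hx, rfl⟩ := (hf.bijOn i m).surjOn hn
        exact ⟨x, ⟨hx, (h x).1 hφ⟩, rfl⟩
      · rintro ⟨x, ⟨hx, hφ⟩, rfl⟩
        exact ⟨(hf.bijOn i m).mapsTo hx, (h x).2 hφ⟩
    simp only [Sat]
    rw [this, Set.InjOn.encard_image ((hf.bijOn i m).injOn.mono fun _ hx => hx.1)]

theorem isCovering_unravelProj (M : LTS.{uP, uI, u} P I) :
    IsCovering M.unravel M M.unravelProj.toFun where
  prop_iff _ _ := Iff.rfl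
  bijOn i l := by
    refine ⟨fun l' h => M.unravelProj.map_act _ _ _ h, ?_, fun n hn => ?_⟩
    · rintro ⟨_, _⟩ ⟨n, -, rfl⟩ ⟨_, _⟩ ⟨n', -, rfl⟩ h
      simp only [unravelProj, endpoint_concat] at h
      exact Subtype.ext (by simp [h])
    · exact ⟨⟨l.1 ++ [(i, n)], (isRun_concat _ _ _ _).2 ⟨l.2, hn⟩⟩, ⟨n, hn, rfl⟩,
        endpoint_concat _ _ _ _⟩

theorem Isomorphic.gmlEquiv {M : LTS.{uP, uI, u} P I} {N : LTS.{uP, uI, v} P I}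
    (e : Isomorphic M N) : GMLEquiv M N := by
  obtain ⟨h, g, h₁, h₂⟩ := e
  have hc : IsCovering M N h.toFun :=
    { prop_iff := fun p m => ⟨fun hm => by simpa [h₁ m] using g.map_prop _ _ hm, h.map_prop p m⟩
      bijOn := fun i m => ⟨fun n hn => h.map_act _ _ _ hn, h₁.injective.injOn,
        fun n hn => ⟨g.toFun n, by simpa [h₁ m] using g.map_act _ _ _ hn, h₂ n⟩⟩ }
  intro φ
  rw [← hc.sat_iff, h.map_pt]

theorem gmlEquiv_of_unravel {M : LTS.{uP, uI, u} P I} {N : LTS.{uP, uI, v} P I}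
    (e : Isomorphic M.unravel N.unravel) : GMLEquiv M N := fun φ =>
  ((isCovering_unravelProj M).sat_iff φ M.unravel.pt).trans <|
    (e.gmlEquiv φ).trans ((isCovering_unravelProj N).sat_iff φ N.unravel.pt).symm

theorem homVectorEq_of_unravel {M : LTS.{uP, uI, u} P I} {N : LTS.{uP, uI, v} P I}
    (e : Isomorphic M.unravel N.unravel) : HomVectorEq IsTree M N := fun T _ hT => by
  rw [← hT.homCount_unravel M, ← hT.homCount_unravel N, e.homCount_eq]

/-! ### Isomorphisms of unravelings from matchings of successors -/

/-- Transport of a list of transitions from `m` to one from `n`, where `σ i m n` sends the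
`i`-successors of `m` to `i`-successors of `n`. -/
def transport {M : LTS.{uP, uI, u} P I} {N : LTS.{uP, uI, v} P I}
    (σ : I → M.State → N.State → M.State → N.State) :
    M.State → N.State → List (I × M.State) → List (I × N.State)
  | _, _, [] => []
  | m, n, (i, x) :: l => (i, σ i m n x) :: transport σ x (σ i m n x) l

theorem transport_concat {M : LTS.{uP, uI, u} P I} {N : LTS.{uP, uI, v} P I}
    (σ : I → M.State → N.State → M.State → N.State) (m : M.State) (n : N.State)
    (l : List (I × M.State)) (i : I) (x : M.State) :
    transport σ m n (l ++ [(i, x)]) = transport σ m n l ++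
      [(i, σ i (M.endpoint m l) (N.endpoint n (transport σ m n l)) x)] := by
  induction l generalizing m n with
  | nil => rfl
  | cons a l ih => simp [transport, endpoint, ih]

/-- `R` is carried along the run, so the one-step hypothesis applies at every stage. The way back
passes through the same pairs of states, hence `τ` undoes `σ` entry by entry. -/
theorem transport_spec {M : LTS.{uP, uI, u} P I} {N : LTS.{uP, uI, v} P I}
    {R : M.State → N.State → Prop} {σ : I → M.State → N.State → M.State → N.State}
    {τ : I → N.State → M.State → N.State → M.State}
    (hσ : ∀ i m n x, R m n → M.act i m x →
      N.act i n (σ i m n x) ∧ R x (σ i m n x) ∧ τ i n m (σ i m n x) = x)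
    (l : List (I × M.State)) (m : M.State) (n : N.State) (h : R m n) (hl : M.IsRun m l) :
    N.IsRun n (transport σ m n l) ∧
      R (M.endpoint m l) (N.endpoint n (transport σ m n l)) ∧
      transport τ n m (transport σ m n l) = l := by
  induction l generalizing m n with
  | nil => exact ⟨trivial, h, rfl⟩
  | cons a l ih =>
    obtain ⟨i, x⟩ := a
    obtain ⟨h₁, h₂, h₃⟩ := hσ i m n x h hl.1
    obtain ⟨k₁, k₂, k₃⟩ := ih x _ h₂ hl.2
    exact ⟨⟨h₁, k₁⟩, k₂, by simp [transport, h₃, k₃]⟩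

def transportHom {M : LTS.{uP, uI, u} P I} {N : LTS.{uP, uI, v} P I}
    {R : M.State → N.State → Prop} {σ : I → M.State → N.State → M.State → N.State}
    {τ : I → N.State → M.State → N.State → M.State}
    (hσ : ∀ i m n x, R m n → M.act i m x →
      N.act i n (σ i m n x) ∧ R x (σ i m n x) ∧ τ i n m (σ i m n x) = x)
    (hR : ∀ p m n, R m n → M.prop p m → N.prop p n) (h : R M.pt N.pt) :
    Hom M.unravel N.unravel where
  toFun l := ⟨transport σ M.pt N.pt l.1, (transport_spec hσ l.1 _ _ h l.2).1⟩
  map_pt := rfl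
  map_prop p l := hR p _ _ (transport_spec hσ l.1 _ _ h l.2).2.1
  map_act := by
    rintro i l ⟨_, _⟩ ⟨x, hx, rfl⟩
    exact ⟨_, (hσ i _ _ x (transport_spec hσ l.1 _ _ h l.2).2.1 hx).1,
      transport_concat σ _ _ _ _ _⟩

/-- The bijection of successors may depend on the pair `(m, n)` of current endpoints. No map between
`M` and `N` themselves is needed, because distinct paths to one state are distinct states of the
unraveling. -/
theorem isomorphic_unravel_of_matching {M : LTS.{uP, uI, u} P I} {N : LTS.{uP, uI, v} P I}
    (R : M.State → N.State → Prop) (h : R M.pt N.pt)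
    (hprop : ∀ p m n, R m n → (M.prop p m ↔ N.prop p n))
    (hact : ∀ i m n, R m n → ∃ e : {x // M.act i m x} ≃ {y // N.act i n y}, ∀ x, R x.1 (e x).1) :
    Isomorphic M.unravel N.unravel := by
  -- The bijections are extended to total functions; the values `N.pt` and `M.pt` off the successors
  -- are never used.
  have key : ∀ i m n, ∃ (s : M.State → N.State) (t : N.State → M.State), R m n →
      (∀ x, M.act i m x → N.act i n (s x) ∧ R x (s x) ∧ t (s x) = x) ∧
      (∀ y, N.act i n y → M.act i m (t y) ∧ R (t y) y ∧ s (t y) = y) := by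
    classical
    intro i m n
    by_cases hmn : R m n
    · obtain ⟨e, he⟩ := hact i m n hmn
      refine ⟨fun x => if hx : M.act i m x then (e ⟨x, hx⟩).1 else N.pt,
        fun y => if hy : N.act i n y then (e.symm ⟨y, hy⟩).1 else M.pt,
        fun _ => ⟨fun x hx => ?_, fun y hy => ?_⟩⟩
      · have := (e ⟨x, hx⟩).2
        simpa [hx, this] using he ⟨x, hx⟩
      · have := (e.symm ⟨y, hy⟩).2
        simpa [hy, this] using he (e.symm ⟨y, hy⟩)
    · exact ⟨fun _ => N.pt, fun _ => M.pt, fun h => absurd h hmn⟩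
  choose σ τ hστ using key
  have hσ := fun i m n x (hmn : R m n) hx => (hστ i m n hmn).1 x hx
  have hτ : ∀ i n m y, (flip R) n m → N.act i n y → M.act i m ((fun i n m => τ i m n) i n m y) ∧
      (flip R) y ((fun i n m => τ i m n) i n m y) ∧
      σ i m n ((fun i n m => τ i m n) i n m y) = y :=
    fun i n m y hmn hy => (hστ i m n hmn).2 y hy
  refine ⟨transportHom (τ := fun i n m => τ i m n) hσ (fun p m n hmn => (hprop p m n hmn).1) h,
    transportHom (R := flip R) hτ (fun p n m hmn => (hprop p m n hmn).2) h, fun l => ?_, fun l => ?_⟩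
  · exact Subtype.ext (transport_spec hσ l.1 _ _ h l.2).2.2
  · exact Subtype.ext (transport_spec (R := flip R) hτ l.1 _ _ h l.2).2.2

theorem ImageFinite.finite_act {M : LTS.{uP, uI, u} P I} (hM : M.ImageFinite) (i : I)
    (m : M.State) : Finite {x // M.act i m x} :=
  ((hM m).subset fun _ hx => ⟨i, hx⟩).to_subtype

/-! ### Graded modal equivalence yields a matching -/

open Classical in
theorem encard_act_sat (M : LTS.{uP, uI, u} P I) (i : I) (m : M.State) (φ : GMLFormula P I)
    [Fintype {x // M.act i m x}] : {x | M.act i m x ∧ M.Sat φ x}.encard =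
      (Finset.univ.filter fun x : {x // M.act i m x} => M.Sat φ x).card := by
  rw [← Set.encard_coe_eq_coe_finsetCard, ← Subtype.val_injective.encard_image]
  congr 1
  ext x
  simp [and_comm]

/-- The family consists of the 0/1 indicators of formulas: `⊤` is the unit, conjunction is the
product, and the sum is a number of successors. -/
theorem isomorphic_unravel_of_gmlEquiv {M : LTS.{uP, uI, u} P I} {N : LTS.{uP, uI, v} P I}
    (hM : M.ImageFinite) (hN : N.ImageFinite) (h : GMLEquiv M N) :
    Isomorphic M.unravel N.unravel := by
  classical
  refine isomorphic_unravel_of_matching (fun m n => ∀ φ, M.Sat φ m ↔ N.Sat φ n) h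
    (fun p m n hmn => hmn (.prop p)) fun i m n hmn => ?_
  have := hM.finite_act i m
  have := hN.finite_act i n
  have := Fintype.ofFinite {x // M.act i m x}
  have := Fintype.ofFinite {y // N.act i n y}
  suffices sum : ∀ φ, (∑ x : {x // M.act i m x}, if M.Sat φ x then (1 : ℚ) else 0) =
      ∑ y : {y // N.act i n y}, if N.Sat φ y then (1 : ℚ) else 0 by
    obtain ⟨e, he⟩ := exists_equiv_of_sum_eq (J := GMLFormula P I)
      (fun φ (x : {x // M.act i m x}) => if M.Sat φ x then 1 else 0)
      (fun φ (y : {y // N.act i n y}) => if N.Sat φ y then 1 else 0)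
      ⟨.top, by simp [Sat], by simp [Sat]⟩
      (fun φ ψ => ⟨.and φ ψ,
        fun x => by by_cases h₁ : M.Sat φ x <;> simp [Sat, h₁],
        fun y => by by_cases h₁ : N.Sat φ y <;> simp [Sat, h₁]⟩) sum
    refine ⟨e, fun x φ => ?_⟩
    have := he φ x
    by_cases h₁ : M.Sat φ x <;> by_cases h₂ : N.Sat φ (e x) <;> simp_all
  intro φ
  simp only [Finset.sum_boole]
  norm_cast
  -- Graded modalities exist only for `k ≥ 1`. Each count is then used as a threshold against the
  -- other, a zero count being trivial.
  have key : ∀ k : ℕ, 0 < k →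
      (k ≤ (Finset.univ.filter fun x : {x // M.act i m x} => M.Sat φ x).card ↔
        k ≤ (Finset.univ.filter fun x : {x // N.act i n x} => N.Sat φ x).card) := by
    intro k hk
    have := hmn (.gdia i ⟨k, hk⟩ φ)
    simp only [Sat, encard_act_sat, PNat.mk_coe] at this
    exact_mod_cast this
  refine le_antisymm ?_ ?_
  · rcases Nat.eq_zero_or_pos
      (Finset.univ.filter fun x : {x // M.act i m x} => M.Sat φ x).card with h0 | h0
    · omega
    · exact (key _ h0).1 le_rfl
  · rcases Nat.eq_zero_or_pos
      (Finset.univ.filter fun x : {x // N.act i n x} => N.Sat φ x).card with h0 | h0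
    · omega
    · exact (key _ h0).2 le_rfl

/-! ### Building finite trees -/

/-- Reachability of all states, together with uniqueness of incoming transitions. -/
structure IsArborescence (T : LTS.{uP, uI, u} P I) : Prop where
  reachable : ∀ m, Relation.ReflTransGen T.Succ T.pt m
  root : ∀ i m, ¬ T.act i m T.pt
  pred_unique : ∀ i j m m' n, T.act i m n → T.act j m' n → i = j ∧ m = m'

/-- Two runs with a common endpoint are compared from their last transitions backwards: the last
transition is forced, and none enters the root. -/
theorem IsArborescence.isTree {T : LTS.{uP, uI, u} P I} (hT : T.IsArborescence) : T.IsTree := by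
  have uniq : ∀ l l' : List (I × T.State), T.IsRun T.pt l → T.IsRun T.pt l' →
      T.endpoint T.pt l = T.endpoint T.pt l' → l = l' := by
    intro l
    induction l using List.reverseRecOn with
    | nil =>
      intro l' _ hl' h
      rcases List.eq_nil_or_concat' l' with rfl | ⟨l', ⟨i, n⟩, rfl⟩
      · rfl
      · rw [isRun_concat] at hl'
        rw [endpoint_concat] at h
        exact absurd (h ▸ hl'.2) (hT.root _ _)
    | append_singleton l a ih =>
      obtain ⟨i, n⟩ := a
      intro l' hl hl' h
      rw [isRun_concat] at hl
      rw [endpoint_concat] at h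
      rcases List.eq_nil_or_concat' l' with rfl | ⟨l', ⟨j, n'⟩, rfl⟩
      · exact absurd (h ▸ hl.2) (hT.root _ _)
      · rw [isRun_concat] at hl'
        rw [endpoint_concat] at h
        subst h
        obtain ⟨rfl, h⟩ := hT.pred_unique _ _ _ _ _ hl.2 hl'.2
        rw [ih l' hl.1 hl'.1 h]
  intro m
  have ex : ∃ l, T.IsRun T.pt l ∧ T.endpoint T.pt l = m := by
    induction hT.reachable m with
    | refl => exact ⟨[], trivial, rfl⟩
    | tail _ hs ih =>
      obtain ⟨i, hi⟩ := hs
      obtain ⟨l, hl, rfl⟩ := ih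
      exact ⟨l ++ [(i, _)], (isRun_concat _ _ _ _).2 ⟨hl, hi⟩, endpoint_concat _ _ _ _⟩
  obtain ⟨l, hl⟩ := ex
  exact ⟨l, hl, fun l' hl' => uniq _ _ hl'.1 hl.1 (hl'.2.trans hl.2.symm)⟩

/-- The same structure with another distinguished state. -/
def withPt (M : LTS.{uP, uI, u} P I) (m : M.State) : LTS.{uP, uI, u} P I := { M with pt := m }

/-- One state, where nothing holds. -/
def point (P : Type uP) (I : Type uI) : LTS.{uP, uI, 0} P I where
  State := Unit
  prop _ _ := False
  act _ _ _ := False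
  pt := ()

/-- `T` with `p` made true at the root. -/
def mark (p : P) (T : LTS.{uP, uI, u} P I) : LTS.{uP, uI, u} P I :=
  { T with prop := fun q m => T.prop q m ∨ (q = p ∧ m = T.pt) }

/-- `T` with `S` attached to the root by an `i`-transition. -/
def attach (i : I) (S T : LTS.{uP, uI, u} P I) : LTS.{uP, uI, u} P I where
  State := T.State ⊕ S.State
  prop q := Sum.elim (T.prop q) (S.prop q)
  act j
    | .inl m, .inl n => T.act j m n
    | .inr m, .inr n => S.act j m n
    | .inl m, .inr n => j = i ∧ m = T.pt ∧ n = S.pt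
    | .inr _, .inl _ => False
  pt := .inl T.pt

theorem isArborescence_point : (point P I).IsArborescence :=
  ⟨fun _ => .refl, fun _ _ h => h, fun _ _ _ _ _ h => h.elim⟩

theorem IsArborescence.mark {T : LTS.{uP, uI, u} P I} (hT : T.IsArborescence) (p : P) :
    (T.mark p).IsArborescence := ⟨hT.reachable, hT.root, hT.pred_unique⟩

theorem IsArborescence.attach {S T : LTS.{uP, uI, u} P I} (hS : S.IsArborescence)
    (hT : T.IsArborescence) (i : I) : (attach i S T).IsArborescence where
  reachable := by
    rintro (m | m)
    · exact (hT.reachable m).lift Sum.inl fun _ _ ⟨j, h⟩ => ⟨j, h⟩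
    · refine .head ⟨i, ?_⟩ ((hS.reachable m).lift Sum.inr fun _ _ ⟨j, h⟩ => ⟨j, h⟩)
      exact ⟨rfl, rfl, rfl⟩
  root := by
    rintro j (m | m) h
    · exact hT.root _ _ h
    · exact h
  pred_unique := by
    rintro j k (m | m) (m' | m') (n | n) h h'
    · obtain ⟨rfl, rfl⟩ := hT.pred_unique _ _ _ _ _ h h'
      exact ⟨rfl, rfl⟩
    · obtain ⟨rfl, rfl, -⟩ := h
      obtain ⟨rfl, rfl, -⟩ := h'
      exact ⟨rfl, rfl⟩
    · exact h'.elim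
    · obtain ⟨-, -, rfl⟩ := h
      exact absurd h' (hS.root _ _)
    · exact h.elim
    · obtain ⟨-, -, rfl⟩ := h'
      exact absurd h (hS.root _ _)
    · exact h.elim
    · obtain ⟨rfl, rfl⟩ := hS.pred_unique _ _ _ _ _ h h'
      exact ⟨rfl, rfl⟩

/-! ### Homomorphism counts of the tree constructions -/

theorem homCount_point (M : LTS.{uP, uI, v} P I) : homCount (point P I) M = 1 := by
  refine Nat.card_eq_one_iff_unique.2 ⟨⟨fun h g => ?_⟩,
    ⟨⟨fun _ => M.pt, rfl, fun _ _ h => h.elim, fun _ _ _ h => h.elim⟩⟩⟩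
  ext x
  exact h.map_pt.trans g.map_pt.symm

open Classical in
theorem homCount_mark (p : P) (T : LTS.{uP, uI, u} P I) (M : LTS.{uP, uI, v} P I) :
    homCount (T.mark p) M = (if M.prop p M.pt then 1 else 0) * homCount T M := by
  split_ifs with h
  · rw [one_mul]
    refine Nat.card_congr ⟨fun g => ⟨g.toFun, g.map_pt, fun q m hm => g.map_prop q m (.inl hm),
      g.map_act⟩, fun g => ⟨g.toFun, g.map_pt, ?_, g.map_act⟩, fun _ => rfl, fun _ => rfl⟩
    rintro q m (hm | ⟨rfl, rfl⟩)
    · exact g.map_prop q m hm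
    · rwa [g.map_pt]
  · rw [zero_mul]
    have : IsEmpty (Hom (T.mark p) M) :=
      ⟨fun g => h (g.map_pt ▸ g.map_prop p T.pt (.inr ⟨rfl, rfl⟩))⟩
    exact Nat.card_of_isEmpty

/-- The two pieces are linked by one transition only. Once the image `x` of the root of `S` is
chosen, the maps on `S` and on `T` are independent. -/
theorem homCount_attach (i : I) (S T : LTS.{uP, uI, u} P I) (M : LTS.{uP, uI, v} P I) :
    homCount (attach i S T) M =
      Nat.card (Σ x : {x // M.act i M.pt x}, Hom S (M.withPt x.1)) * homCount T M := by
  rw [homCount, homCount, ← Nat.card_prod]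
  refine Nat.card_congr
    { toFun := fun g =>
        (⟨⟨g.toFun (.inr S.pt), g.map_pt ▸ g.map_act i (.inl T.pt) (.inr S.pt) ⟨rfl, rfl, rfl⟩⟩,
          ⟨fun s => g.toFun (.inr s), rfl, fun p s => g.map_prop p (.inr s),
            fun j s t => g.map_act j (.inr s) (.inr t)⟩⟩,
          ⟨fun t => g.toFun (.inl t), g.map_pt, fun p s => g.map_prop p (.inl s),
            fun j s t => g.map_act j (.inl s) (.inl t)⟩)
      invFun := fun a =>
        { toFun := Sum.elim a.2.toFun a.1.2.toFun
          map_pt := a.2.map_pt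
          map_prop := by
            rintro p (m | m) h
            · exact a.2.map_prop p m h
            · exact a.1.2.map_prop p m h
          map_act := by
            rintro j (m | m) (n | n) h
            · exact a.2.map_act j m n h
            · obtain ⟨rfl, rfl, rfl⟩ := h
              simpa [a.2.map_pt, a.1.2.map_pt, withPt] using a.1.1.2
            · exact h.elim
            · exact a.1.2.map_act j m n h }
      left_inv := ?_
      right_inv := ?_ }
  · intro g
    ext (m | m) <;> rfl
  -- Substituting `f S.pt` for `x` removes the dependence of the type of `f` on the chosen
  -- successor.
  · rintro ⟨⟨⟨x, hx⟩, f, hf, h₁, h₂⟩, g⟩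
    change S.State → M.State at f
    change f S.pt = x at hf
    subst hf
    rfl

/-- Codes for finite trees: a list of proposition letters and of labelled subtrees. -/
inductive TreeCode (P : Type uP) (I : Type uI) where
  | nil : TreeCode P I
  | mark (p : P) (t : TreeCode P I) : TreeCode P I
  | attach (i : I) (s t : TreeCode P I) : TreeCode P I

namespace TreeCode

def toLTS : TreeCode P I → LTS.{uP, uI, 0} P I
  | nil => point P I
  | mark p t => t.toLTS.mark p
  | attach i s t => LTS.attach i s.toLTS t.toLTS

def append : TreeCode P I → TreeCode P I → TreeCode P I
  | nil, t' => t'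
  | mark p t, t' => mark p (t.append t')
  | attach i s t, t' => attach i s (t.append t')

theorem isTree_toLTS (t : TreeCode P I) : t.toLTS.IsTree := by
  refine IsArborescence.isTree ?_
  induction t with
  | nil => exact isArborescence_point
  | mark p t ih => exact ih.mark p
  | attach i s t hs ht => exact hs.attach ht i

instance finite_toLTS (t : TreeCode P I) : Finite t.toLTS.State := by
  induction t with
  | nil => exact inferInstanceAs (Finite Unit)
  | mark p t ih => exact ih
  | attach i s t hs ht => exact inferInstanceAs (Finite (t.toLTS.State ⊕ s.toLTS.State))

/-- Appending codes glues trees at their roots; this supplies closure under products. -/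
theorem homCount_append (t t' : TreeCode P I) (M : LTS.{uP, uI, v} P I) :
    homCount (t.append t').toLTS M = homCount t.toLTS M * homCount t'.toLTS M := by
  induction t with
  | nil => simp [append, toLTS, homCount_point]
  | mark p t ih => simp only [append, toLTS, homCount_mark, ih, mul_assoc]
  | attach i s t _ ih => simp only [append, toLTS, homCount_attach, ih, mul_assoc]

end TreeCode

/-! ### Equality of homomorphism counts yields a matching -/

theorem isomorphic_unravel_of_homVectorEq {M : LTS.{uP, uI, u} P I} {N : LTS.{uP, uI, v} P I}
    (hM : M.ImageFinite) (hN : N.ImageFinite) (h : HomVectorEq IsTree M N) :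
    Isomorphic M.unravel N.unravel := by
  refine isomorphic_unravel_of_matching
    (fun m n => ∀ t : TreeCode P I,
      homCount t.toLTS (M.withPt m) = homCount t.toLTS (N.withPt n))
    (fun t => h _ t.finite_toLTS t.isTree_toLTS) (fun p m n hmn => ?_) fun i m n hmn => ?_
  · have := hmn (.mark p .nil)
    simp only [TreeCode.toLTS, homCount_mark, homCount_point, mul_one, withPt] at this
    by_cases h₁ : M.prop p m <;> by_cases h₂ : N.prop p n <;> simp_all
  · have := hM.finite_act i m
    have := hN.finite_act i n
    have := Fintype.ofFinite {x // M.act i m x}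
    have := Fintype.ofFinite {y // N.act i n y}
    suffices sum : ∀ t : TreeCode P I,
        ∑ x : {x // M.act i m x}, (homCount t.toLTS (M.withPt x.1) : ℚ) =
          ∑ y : {y // N.act i n y}, (homCount t.toLTS (N.withPt y.1) : ℚ) by
      obtain ⟨e, he⟩ := exists_equiv_of_sum_eq (J := TreeCode P I)
        (fun t (x : {x // M.act i m x}) => (homCount t.toLTS (M.withPt x.1) : ℚ))
        (fun t (y : {y // N.act i n y}) => (homCount t.toLTS (N.withPt y.1) : ℚ))
        ⟨.nil, by simp [TreeCode.toLTS, homCount_point], by simp [TreeCode.toLTS, homCount_point]⟩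
        (fun s t => ⟨s.append t, by simp [TreeCode.homCount_append],
          by simp [TreeCode.homCount_append]⟩) sum
      exact ⟨e, fun x t => by exact_mod_cast (he t x).symm⟩
    intro t
    -- Hanging `t` below a bare root turns a count at `m` into the sum of the counts at its
    -- `i`-successors.
    have eq := hmn (.attach i t .nil)
    simp only [TreeCode.toLTS, homCount_attach, homCount_point, mul_one] at eq
    -- Finite fibres are required for `Nat.card` of the sigma type to be the sum of the
    -- cardinalities.
    have finM : ∀ x : {x // M.act i m x}, Finite (Hom t.toLTS (M.withPt x.1)) :=
      fun x => finite_hom_of_isTree _ _ t.isTree_toLTS hM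
    have finN : ∀ y : {y // N.act i n y}, Finite (Hom t.toLTS (N.withPt y.1)) :=
      fun y => finite_hom_of_isTree _ _ t.isTree_toLTS hN
    have eM := Nat.card_sigma (β := fun x : {x // M.act i m x} => Hom t.toLTS (M.withPt x.1))
    have eN := Nat.card_sigma (β := fun y : {y // N.act i n y} => Hom t.toLTS (N.withPt y.1))
    have := eM.symm.trans (eq.trans eN)
    exact_mod_cast this

/-! ### The equivalence for labelled paths -/

theorem tfae_homVectorEq_unravel_gmlEquiv {M : LTS.{uP, uI, u} P I} {N : LTS.{uP, uI, v} P I}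
    (hM : M.ImageFinite) (hN : N.ImageFinite) :
    [HomVectorEq IsTree M N, Isomorphic M.unravel N.unravel, GMLEquiv M N].TFAE := by
  tfae_have 1 → 2 := isomorphic_unravel_of_homVectorEq hM hN
  tfae_have 2 → 1 := homVectorEq_of_unravel
  tfae_have 2 → 3 := gmlEquiv_of_unravel
  tfae_have 3 → 2 := isomorphic_unravel_of_gmlEquiv hM hN
  tfae_finish

/-! ### Paths as sequences of states -/

theorem IsRun.isStateRun {M : LTS.{uP, uI, u} P I} (l : List (I × M.State)) (m : M.State)
    (h : M.IsRun m l) : M.IsStateRun m (m :: l.map Prod.snd) := by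
  induction l generalizing m with
  | nil => exact ⟨rfl, List.isChain_singleton _⟩
  | cons a l ih => exact ⟨rfl, List.isChain_cons_cons.2 ⟨⟨a.1, h.1⟩, (ih a.2 h.2).2⟩⟩

theorem getLast?_cons_map_snd {M : LTS.{uP, uI, u} P I} (l : List (I × M.State)) (m : M.State) :
    (m :: l.map Prod.snd).getLast? = some (M.endpoint m l) := by
  induction l generalizing m with
  | nil => rfl
  | cons a l ih => simpa [endpoint] using ih a.2

theorem IsStateRun.exists_isRun {M : LTS.{uP, uI, u} P I} (s : List M.State) (m : M.State)
    (h : M.IsStateRun m s) : ∃ l, M.IsRun m l ∧ m :: l.map Prod.snd = s := by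
  induction s generalizing m with
  | nil => simp [IsStateRun] at h
  | cons a s ih =>
    obtain ⟨h₁, h₂⟩ := h
    obtain rfl : a = m := by simpa using h₁
    cases s with
    | nil => exact ⟨[], trivial, rfl⟩
    | cons b s =>
      rw [List.isChain_cons_cons] at h₂
      obtain ⟨⟨i, hi⟩, h₂⟩ := h₂
      obtain ⟨l, hl, e⟩ := ih b ⟨rfl, h₂⟩
      exact ⟨(i, b) :: l, ⟨hi, hl⟩, by simpa using e⟩

theorem ActionsDisjoint.run_eq {M : LTS.{uP, uI, u} P I} (hM : M.ActionsDisjoint)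
    (l l' : List (I × M.State)) (m : M.State) (hl : M.IsRun m l) (hl' : M.IsRun m l')
    (h : l.map Prod.snd = l'.map Prod.snd) : l = l' := by
  induction l generalizing m l' with
  | nil => simpa using h.symm
  | cons a l ih =>
    cases l' with
    | nil => simp at h
    | cons b l' =>
      obtain ⟨i, x⟩ := a
      obtain ⟨j, y⟩ := b
      simp only [List.map_cons, List.cons.injEq] at h
      obtain ⟨rfl, h⟩ := h
      rw [hM i j m x hl.1 hl'.1, ih l' x hl.2 hl'.2 h]

/-- Every state sequence lifts to a run, and disjointness makes the lift unique. Conversely, two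
actions on one pair of states would give two runs to the same state. -/
theorem isTree_iff_isPairTree {T : LTS.{uP, uI, u} P I} :
    T.IsTree ↔ T.IsPairTree ∧ T.ActionsDisjoint := by
  constructor
  · intro hT
    refine ⟨fun m => ⟨T.pt :: (hT.run m).map Prod.snd, ⟨(hT.isRun_run m).isStateRun, ?_⟩, ?_⟩, ?_⟩
    · rw [getLast?_cons_map_snd, hT.endpoint_run]
    · rintro s ⟨hs, e⟩
      obtain ⟨l, hl, rfl⟩ := IsStateRun.exists_isRun s _ hs
      rw [getLast?_cons_map_snd, Option.some.injEq] at e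
      rw [hT.run_unique hl (hT.isRun_run m) (e.trans (hT.endpoint_run m).symm)]
    · intro i j m n hi hj
      simpa using (hT.run_of_act hi).symm.trans (hT.run_of_act hj)
  · rintro ⟨hT, hd⟩ m
    obtain ⟨s, ⟨hs, e⟩, uniq⟩ := hT m
    obtain ⟨l, hl, rfl⟩ := IsStateRun.exists_isRun s _ hs
    rw [getLast?_cons_map_snd, Option.some.injEq] at e
    refine ⟨l, ⟨hl, e⟩, fun l' ⟨hl', e'⟩ => hd.run_eq _ _ _ hl' hl ?_⟩
    simpa using uniq _ ⟨hl'.isStateRun, by rw [getLast?_cons_map_snd, e']⟩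

theorem homCount_eq_zero {T : LTS.{uP, uI, u} P I} {M : LTS.{uP, uI, v} P I}
    (hM : M.ActionsDisjoint) (hT : ¬ T.ActionsDisjoint) : homCount T M = 0 := by
  have : IsEmpty (Hom T M) := ⟨fun h => hT fun i j m n hi hj =>
    hM i j _ _ (h.map_act _ _ _ hi) (h.map_act _ _ _ hj)⟩
  exact Nat.card_of_isEmpty

/-- The additional trees have a doubled transition, which cannot be mapped into a structure with
disjoint actions, so they contribute 0 on both sides. -/
theorem homVectorEq_isPairTree_iff {M : LTS.{uP, uI, u} P I} {N : LTS.{uP, uI, v} P I}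
    (hM : M.ActionsDisjoint) (hN : N.ActionsDisjoint) :
    HomVectorEq IsPairTree M N ↔ HomVectorEq IsTree M N := by
  refine ⟨fun h T hf hT => h T hf (isTree_iff_isPairTree.1 hT).1, fun h T hf hT => ?_⟩
  by_cases hd : T.ActionsDisjoint
  · exact h T hf (isTree_iff_isPairTree.2 ⟨hT, hd⟩)
  · rw [homCount_eq_zero hM hd, homCount_eq_zero hN hd]

theorem isomorphic_unravel_stateUnravel {M : LTS.{uP, uI, u} P I} (hM : M.ActionsDisjoint) :
    Isomorphic M.unravel M.stateUnravel := by
  let f : M.unravel.State → M.stateUnravel.State :=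
    fun l => ⟨M.pt :: l.1.map Prod.snd, IsRun.isStateRun _ _ l.2⟩
  have inj : Function.Injective f := fun l l' h => Subtype.ext <|
    hM.run_eq _ _ _ l.2 l'.2 (List.cons.inj (congrArg Subtype.val h)).2
  have surj : Function.Surjective f := fun s => by
    obtain ⟨l, hl, e⟩ := IsStateRun.exists_isRun s.1 _ s.2
    exact ⟨⟨l, hl⟩, Subtype.ext e⟩
  have hprop : ∀ p l, M.unravel.prop p l ↔ M.stateUnravel.prop p (f l) := fun p l => by
    simp only [unravel, stateUnravel, f, getLast?_cons_map_snd, Option.some.injEq,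
      exists_eq_left']
  have hact : ∀ i l l', M.unravel.act i l l' ↔ M.stateUnravel.act i (f l) (f l') := by
    intro i l l'
    constructor
    · rintro ⟨n, hn, e⟩
      exact ⟨_, n, getLast?_cons_map_snd _ _, hn, by simp [f, e]⟩
    · rintro ⟨m, n, hm, hn, e⟩
      obtain rfl : M.endpoint M.pt l.1 = m := by
        simpa only [f, getLast?_cons_map_snd, Option.some.injEq] using hm
      -- The state sequence of `l'` does not show its last label; disjointness recovers it as `i`.
      refine ⟨n, hn, hM.run_eq _ _ _ l'.2 ((isRun_concat _ _ _ _).2 ⟨l.2, hn⟩) ?_⟩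
      simpa [f] using e
  let e := Equiv.ofBijective f ⟨inj, surj⟩
  refine ⟨⟨f, rfl, fun p l => (hprop p l).1, fun i l l' => (hact i l l').1⟩,
    ⟨e.symm, e.symm_apply_eq.2 rfl, fun p s h => (hprop p _).2 ?_,
      fun i s s' h => (hact i _ _).2 ?_⟩, e.left_inv, e.right_inv⟩
  · rwa [show f (e.symm s) = s from e.apply_symm_apply s]
  · rwa [show f (e.symm s) = s from e.apply_symm_apply s,
      show f (e.symm s') = s' from e.apply_symm_apply s']

theorem isomorphic_stateUnravel_iff {M : LTS.{uP, uI, u} P I} {N : LTS.{uP, uI, v} P I}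
    (hM : M.ActionsDisjoint) (hN : N.ActionsDisjoint) :
    Isomorphic M.stateUnravel N.stateUnravel ↔ Isomorphic M.unravel N.unravel :=
  have eM := isomorphic_unravel_stateUnravel hM
  have eN := isomorphic_unravel_stateUnravel hN
  ⟨fun h => (eM.trans h).trans eN.symm, fun h => (eM.symm.trans h).trans eN⟩

end LTS

theorem mainTheorem8 {P : Type uP} {I : Type uI} [Finite P] [Finite I]
    (M : LTS.{uP, uI, u} P I) (N : LTS.{uP, uI, v} P I)
    (hM : M.ImageFinite) (hN : N.ImageFinite) :
    [ LTS.HomVectorEq LTS.IsTree M N,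
      LTS.Isomorphic M.unravel N.unravel,
      LTS.GMLEquiv M N ].TFAE ∧
    (M.ActionsDisjoint → N.ActionsDisjoint →
      [ LTS.HomVectorEq LTS.IsPairTree M N,
        LTS.Isomorphic M.stateUnravel N.stateUnravel,
        LTS.GMLEquiv M N ].TFAE) := by
  have h := LTS.tfae_homVectorEq_unravel_gmlEquiv hM hN
  refine ⟨h, fun dM dN => ?_⟩
  rwa [LTS.homVectorEq_isPairTree_iff dM dN, LTS.isomorphic_stateUnravel_iff dM dN]
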